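/- Let $\mathbb D=\langle D,<\rangle$ be the countable random poset, i.e. the countable partial order (unique up to isomorphism) that is ultrahomogeneous (each isomorphism between finite suborders of $\mathbb D$ extends to an automorphism of $\mathbb D$) and universal (each countable partial order embeds in $\mathbb D$ as a suborder). Let $\mathbb P(\mathbb D)$ be the set of all $A\subset D$ such that the suborder $\langle A,<\rangle$ is isomorphic to $\mathbb D$. Let $L$ be a linear order that embeds in the real line and is complete, meaning that it has a least element $0_L$ and a greatest element and has no gaps (whenever $L=A\cup B$ with $A,B$ nonempty and $a<b$ for all $a\in A$, $b\in B$, either $A$ has a maximum or $B$ has a minimum). Suppose that $0_L$ is non-isolated, i.e. $L\neq\{0_L\}$ and for each $x>0_L$ there is $y\in L$ with $0_L<y<x$. Then there is a maximal chain $\mathcal L$ in the partially ordered set $\langle \mathbb P(\mathbb D)\cup\{\emptyset\},\subset\rangle$ such that $\langle\mathcal L,\subset\rangle$ is isomorphic to $L$. -/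

import Mathlib

/-- A partial order is *ultrahomogeneous* if every isomorphism between two of its finite suborders
extends to an automorphism. -/
def IsUltrahomogeneousOrder (D : Type*) [PartialOrder D] : Prop :=
  ∀ (A B : Set D), A.Finite → B.Finite → ∀ φ : A ≃o B,
    ∃ ψ : D ≃o D, ∀ a : A, ψ (a : D) = (φ a : D)

/-- A partial order is *universal* (for countable partial orders) if every at most countable
partial order embeds into it as a suborder. (Every countable partial order has an isomorphic copy
in the lowest universe.) -/
def IsUniversalOrder (D : Type*) [PartialOrder D] : Prop :=
  ∀ (P : Type) [PartialOrder P] [Countable P], Nonempty (P ↪o D)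

/-- The countable random poset: a countable ultrahomogeneous universal partial order
(such an order exists and is unique up to isomorphism; universality makes it infinite). -/
structure IsRandomPoset (D : Type*) [PartialOrder D] : Prop where
  countable : Countable D
  ultrahomogeneous : IsUltrahomogeneousOrder D
  universal : IsUniversalOrder D

/-- `copies D` is the set of all `A ⊆ D` such that the suborder `A` is isomorphic to `D`. -/
def copies (D : Type*) [PartialOrder D] : Set (Set D) :=
  {A | Nonempty (A ≃o D)}

/-- A linear order is *complete* if it has a least and a greatest element and has no gaps:
for each cut `(A, B)`, either `A` has a greatest element or `B` has a least one. -/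
structure IsCompleteLinearOrder (L : Type*) [LinearOrder L] : Prop where
  exists_bot : ∃ o : L, IsBot o
  exists_top : ∃ i : L, IsTop i
  no_gaps : ∀ A B : Set L, A.Nonempty → B.Nonempty → A ∪ B = Set.univ →
    (∀ a ∈ A, ∀ b ∈ B, a < b) → (∃ m, IsGreatest A m) ∨ (∃ m, IsLeast B m)

/-- The linear order embeds into the real line. -/
def IsRealEmbeddable (L : Type*) [LinearOrder L] : Prop :=
  Nonempty (L ↪o ℝ)

/-- The linear order has a least element, and it is not an isolated point of the order: there are
elements above it, and below each of them there is a further one. -/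
def HasNonisolatedBot (L : Type*) [LinearOrder L] : Prop :=
  ∃ o : L, IsBot o ∧ (∃ x, o < x) ∧ ∀ x, o < x → ∃ y, o < y ∧ y < x

/-! Label the points of `D` injectively by a countable set `W` in `L`, and take as chain the sets of
points with label at most `x`. Labels with an immediate predecessor account for the jumps of `L`;
the remaining labels form a set `T` of two-sided limits, making `W` accumulate wherever `L` has no
jump. At `x ∈ T` both "label `< x`" and "label `≤ x`" would be comparable with the whole chain. Only
the first is kept, and the second is killed by requiring labels to increase strictly above points
labelled in `T`: its last point is then maximal, while `D` has no maximal elements.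

The labelling comes from a generic order on `W` obeying this constraint (`exists_generic`), in which
every finite one-point type has witnesses with label below any admissible bound. Room for witnesses
exists because points of `T` have no immediate successor and `0_L` is not isolated. Genericity makes
`W` and every nonempty section random (`labelSection_mem_copies`); completeness of `L` gives
maximality (`eq_labelSection_or`). -/

/-! ### The extension property and uniqueness of the random poset -/

/-- The one-point extension property, which characterizes the random poset among countable posets. -/
def HasExtensionProperty (P : Type*) [PartialOrder P] : Prop :=
  ∀ A B C : Finset P, (∀ a ∈ A, ∀ b ∈ B, a < b) → (∀ c ∈ C, ∀ a ∈ A, ¬ c ≤ a) →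
    (∀ c ∈ C, ∀ b ∈ B, ¬ b ≤ c) →
    ∃ z, (∀ a ∈ A, a < z) ∧ (∀ b ∈ B, z < b) ∧ ∀ c ∈ C, ¬ c ≤ z ∧ ¬ z ≤ c

/-- The relation on `Option P` in which `none` lies exactly above the lower closure of `A`
and below the upper closure of `B`. -/
def PointExtensionLE {P : Type*} [LE P] (A B : Set P) : Option P → Option P → Prop
  | some x, some y => x ≤ y
  | some x, none => ∃ a ∈ A, x ≤ a
  | none, some y => ∃ b ∈ B, b ≤ y
  | none, none => True

/-- The one-point extension of a partial order given by a set `A` lying below a set `B`. -/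
abbrev pointExtension {P : Type*} [PartialOrder P] (A B : Set P)
    (h : ∀ a ∈ A, ∀ b ∈ B, a < b) : PartialOrder (Option P) where
  le := PointExtensionLE A B
  lt x y := PointExtensionLE A B x y ∧ ¬ PointExtensionLE A B y x
  le_refl x := by cases x <;> simp [PointExtensionLE]
  le_trans := by
    rintro (_ | x) (_ | y) (_ | z) h₁ h₂ <;> simp only [PointExtensionLE] at h₁ h₂ ⊢
    · exact h₂
    · obtain ⟨b, hb, hy⟩ := h₁
      exact ⟨b, hb, hy.trans h₂⟩
    · exact h₁
    · obtain ⟨a, ha, hx⟩ := h₁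
      obtain ⟨b, hb, hz⟩ := h₂
      exact hx.trans ((h a ha b hb).le.trans hz)
    · obtain ⟨a, ha, hy⟩ := h₂
      exact ⟨a, ha, h₁.trans hy⟩
    · exact h₁.trans h₂
  le_antisymm := by
    rintro (_ | x) (_ | y) h₁ h₂ <;> simp only [PointExtensionLE] at h₁ h₂ ⊢
    · obtain ⟨b, hb, hy⟩ := h₁
      obtain ⟨a, ha, hy'⟩ := h₂
      exact absurd ((h a ha b hb).trans_le (hy.trans hy')) (lt_irrefl _)
    · obtain ⟨a, ha, hy'⟩ := h₁
      obtain ⟨b, hb, hy⟩ := h₂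
      exact absurd ((h a ha b hb).trans_le (hy.trans hy')) (lt_irrefl _)
    · exact congrArg some (le_antisymm h₁ h₂)

theorem IsUniversalOrder.nonempty_orderEmbedding {D : Type*} [PartialOrder D]
    (hD : IsUniversalOrder D) (P : Type*) [PartialOrder P] [Countable P] : Nonempty (P ↪o D) := by
  let e := equivShrink.{0} P
  let _ : PartialOrder (Shrink.{0} P) := PartialOrder.lift e.symm e.symm.injective
  have : Countable (Shrink.{0} P) := e.symm.injective.countable
  obtain ⟨f⟩ := hD (Shrink.{0} P)
  have he : ∀ a b : P, e a ≤ e b ↔ a ≤ b := fun a b => by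
    change e.symm (e a) ≤ e.symm (e b) ↔ a ≤ b
    simp
  exact ⟨(OrderEmbedding.ofMapLEIff e he).trans f⟩

/-- Adjoin the wanted point to all of `D` and embed the result in `D`. An automorphism extending the
embedding on `A ∪ B ∪ C` carries the new point back to its place over the original finite set. -/
theorem IsRandomPoset.hasExtensionProperty {D : Type*} [PartialOrder D] (hD : IsRandomPoset D) :
    HasExtensionProperty D := by
  classical
  intro A B C hAB hCA hCB
  have := hD.countable
  let inst := pointExtension (A : Set D) (B : Set D) hAB
  obtain ⟨e⟩ := @IsUniversalOrder.nonempty_orderEmbedding D _ hD.universal (Option D) inst _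
  have hes : ∀ x y : D, e (some x) ≤ e (some y) ↔ x ≤ y := fun x y => e.le_iff_le
  have hen : ∀ x : D, e (some x) ≤ e none ↔ ∃ a ∈ A, x ≤ a := fun x => e.le_iff_le
  have hne : ∀ x : D, e none ≤ e (some x) ↔ ∃ b ∈ B, b ≤ x := fun x => e.le_iff_le
  have hinj : Function.Injective fun x : D => e (some x) :=
    fun x y h => Option.some_injective _ (e.injective h)
  let F : Set D := ↑(A ∪ B ∪ C)
  let φ : F ≃o ((fun x : D => e (some x)) '' F) :=
    { Equiv.Set.image (fun x : D => e (some x)) F hinj with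
      map_rel_iff' := by
        rintro ⟨x, hx⟩ ⟨y, hy⟩
        exact hes x y }
  obtain ⟨ψ, hψ⟩ := hD.ultrahomogeneous F _ (Finset.finite_toSet _)
    ((Finset.finite_toSet _).image _) φ
  have hψ' : ∀ x ∈ A ∪ B ∪ C, ψ x = e (some x) := fun x hx => hψ ⟨x, hx⟩
  have hle : ∀ x ∈ A ∪ B ∪ C, (x ≤ ψ.symm (e none) ↔ ∃ a ∈ A, x ≤ a) := fun x hx => by
    rw [← hen, ← hψ' x hx, ψ.le_symm_apply]
  have hge : ∀ x ∈ A ∪ B ∪ C, (ψ.symm (e none) ≤ x ↔ ∃ b ∈ B, b ≤ x) := fun x hx => by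
    rw [← hne, ← hψ' x hx, ψ.symm_apply_le]
  refine ⟨ψ.symm (e none), fun a ha => ?_, fun b hb => ?_, fun c hc => ⟨?_, ?_⟩⟩
  · have ha' : a ∈ A ∪ B ∪ C := by simp [ha]
    rw [lt_iff_le_not_ge, hle a ha', hge a ha']
    refine ⟨⟨a, ha, le_rfl⟩, ?_⟩
    rintro ⟨b, hb, hba⟩
    exact (hAB a ha b hb).not_ge hba
  · have hb' : b ∈ A ∪ B ∪ C := by simp [hb]
    rw [lt_iff_le_not_ge, hle b hb', hge b hb']
    refine ⟨⟨b, hb, le_rfl⟩, ?_⟩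
    rintro ⟨a, ha, hba⟩
    exact (hAB a ha b hb).not_ge hba
  · rw [hle c (by simp [hc])]
    rintro ⟨a, ha, h⟩
    exact hCA c hc a ha h
  · rw [hge c (by simp [hc])]
    rintro ⟨b, hb, h⟩
    exact hCB c hc b hb h

/-- Finite partial isomorphisms, given by their graphs. -/
def FinitePartialIso (P Q : Type*) [PartialOrder P] [PartialOrder Q] : Type _ :=
  {f : Finset (P × Q) // ∀ x ∈ f, ∀ y ∈ f, x.1 ≤ y.1 ↔ x.2 ≤ y.2}

instance (P Q : Type*) [PartialOrder P] [PartialOrder Q] : Preorder (FinitePartialIso P Q) :=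
  Subtype.preorder _

theorem HasExtensionProperty.exists_image {P Q : Type*} [PartialOrder P] [PartialOrder Q]
    (hQ : HasExtensionProperty Q) {f : Finset (P × Q)}
    (hf : ∀ x ∈ f, ∀ y ∈ f, x.1 ≤ y.1 ↔ x.2 ≤ y.2) (p : P) :
    ∃ q, ∀ x ∈ f, (x.1 ≤ p ↔ x.2 ≤ q) ∧ (p ≤ x.1 ↔ q ≤ x.2) := by
  classical
  by_cases hp : ∃ x ∈ f, x.1 = p
  · obtain ⟨x, hx, rfl⟩ := hp
    exact ⟨x.2, fun y hy => ⟨hf y hy x hx, hf x hx y hy⟩⟩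
  push Not at hp
  have hlt : ∀ x ∈ f, ∀ y ∈ f, x.1 < y.1 ↔ x.2 < y.2 := fun x hx y hy => by
    rw [lt_iff_le_not_ge, lt_iff_le_not_ge, hf x hx y hy, hf y hy x hx]
  obtain ⟨q, hA, hB, hC⟩ := hQ ((f.filter fun x => x.1 ≤ p).image Prod.snd)
    ((f.filter fun x => p ≤ x.1).image Prod.snd)
    ((f.filter fun x => ¬ x.1 ≤ p ∧ ¬ p ≤ x.1).image Prod.snd)
    (by
      simp only [Finset.forall_mem_image, Finset.mem_filter, and_imp]
      intro x hx hxp y hy hyp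
      exact (hlt x hx y hy).1 ((hxp.lt_of_ne (hp x hx)).trans_le hyp))
    (by
      simp only [Finset.forall_mem_image, Finset.mem_filter, and_imp]
      intro x hx hxp _ y hy hyp h
      exact hxp (((hf x hx y hy).2 h).trans hyp))
    (by
      simp only [Finset.forall_mem_image, Finset.mem_filter, and_imp]
      intro x hx _ hxp y hy hyp h
      exact hxp (hyp.trans ((hf y hy x hx).2 h)))
  simp only [Finset.forall_mem_image, Finset.mem_filter, and_imp] at hA hB hC
  refine ⟨q, fun x hx => ?_⟩
  by_cases h₁ : x.1 ≤ p
  · have h₂ : ¬ p ≤ x.1 := fun h => hp x hx (le_antisymm h₁ h)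
    have := hA hx h₁
    simp [h₁, h₂, this.le, this.not_ge]
  · by_cases h₂ : p ≤ x.1
    · have := hB hx h₂
      simp [h₁, h₂, this.le, this.not_ge]
    · simp [h₁, h₂, hC hx h₁ h₂]

/-- Back and forth. -/
theorem HasExtensionProperty.nonempty_orderIso {P Q : Type*} [PartialOrder P] [PartialOrder Q]
    [Countable P] [Countable Q] (hP : HasExtensionProperty P) (hQ : HasExtensionProperty Q) :
    Nonempty (P ≃o Q) := by
  classical
  have := Encodable.ofCountable P
  have := Encodable.ofCountable Q
  have insertMem : ∀ (f : FinitePartialIso P Q) (p : P) (q : Q),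
      (∀ x ∈ f.1, (x.1 ≤ p ↔ x.2 ≤ q) ∧ (p ≤ x.1 ↔ q ≤ x.2)) →
      ∃ g : FinitePartialIso P Q, (p, q) ∈ g.1 ∧ f ≤ g := by
    intro f p q h
    refine ⟨⟨insert (p, q) f.1, ?_⟩, Finset.mem_insert_self _ _, Finset.subset_insert _ _⟩
    simp only [Finset.forall_mem_insert, le_refl, true_and]
    exact ⟨fun x hx => (h x hx).2, fun x hx => ⟨(h x hx).1, f.2 x hx⟩⟩
  let left (p : P) : Order.Cofinal (FinitePartialIso P Q) :=
    { carrier := {f | ∃ q, (p, q) ∈ f.1}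
      isCofinal := fun f => by
        obtain ⟨q, hq⟩ := hQ.exists_image f.2 p
        obtain ⟨g, hg, hfg⟩ := insertMem f p q hq
        exact ⟨g, ⟨q, hg⟩, hfg⟩ }
  let right (q : Q) : Order.Cofinal (FinitePartialIso P Q) :=
    { carrier := {f | ∃ p, (p, q) ∈ f.1}
      isCofinal := fun f => by
        obtain ⟨p, hp⟩ := hP.exists_image (f := f.1.image Prod.swap)
          (by
            simp only [Finset.forall_mem_image]
            exact fun x hx y hy => (f.2 x hx y hy).symm) q
        simp only [Finset.forall_mem_image] at hp
        obtain ⟨g, hg, hfg⟩ := insertMem f p q fun x hx => ⟨(hp hx).1.symm, (hp hx).2.symm⟩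
        exact ⟨g, ⟨p, hg⟩, hfg⟩ }
  -- The union of the graphs in an ideal meeting every `left p` and `right q` is total and
  -- surjective.
  let I := Order.idealOfCofinals (⟨∅, by simp⟩ : FinitePartialIso P Q) (Sum.elim left right)
  have hl : ∀ p, ∃ q, ∃ f ∈ I, (p, q) ∈ f.1 := fun p => by
    obtain ⟨f, ⟨q, hq⟩, hf⟩ := Order.cofinal_meets_idealOfCofinals ⟨∅, by simp⟩
      (Sum.elim left right) (Sum.inl p)
    exact ⟨q, f, hf, hq⟩
  have hr : ∀ q, ∃ p, ∃ f ∈ I, (p, q) ∈ f.1 := fun q => by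
    obtain ⟨f, ⟨p, hp⟩, hf⟩ := Order.cofinal_meets_idealOfCofinals ⟨∅, by simp⟩
      (Sum.elim left right) (Sum.inr q)
    exact ⟨p, f, hf, hp⟩
  have compat : ∀ p q p' q', (∃ f ∈ I, (p, q) ∈ f.1) → (∃ f ∈ I, (p', q') ∈ f.1) →
      (p ≤ p' ↔ q ≤ q') := by
    rintro p q p' q' ⟨f, hf, h⟩ ⟨f', hf', h'⟩
    obtain ⟨g, -, hg, hg'⟩ := I.directed f hf f' hf'
    exact g.2 _ (hg h) _ (hg' h')
  choose F hF using hl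
  choose G hG using hr
  refine ⟨⟨⟨F, G, fun p => ?_, fun q => ?_⟩, (compat _ _ _ _ (hF _) (hF _)).symm⟩⟩
  · exact le_antisymm ((compat _ _ _ _ (hG _) (hF p)).2 le_rfl)
      ((compat _ _ _ _ (hF p) (hG _)).2 le_rfl)
  · exact le_antisymm ((compat _ _ _ _ (hF _) (hG q)).1 le_rfl)
      ((compat _ _ _ _ (hG q) (hF _)).1 le_rfl)

/-! ### A generic order by finite approximations -/

/-- A finite approximation to a strict partial order on the linear order `W` which is contained in
the linear order at the points of `T`. -/
structure FiniteStage {W : Type*} [LinearOrder W] (T : Set W) where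
  support : Finset W
  rel : W → W → Prop
  mem_of_rel : ∀ x y, rel x y → x ∈ support ∧ y ∈ support
  irrefl : ∀ x, ¬ rel x x
  trans : ∀ x y z, rel x y → rel y z → rel x z
  lt_of_rel : ∀ x y, rel x y → x ∈ T → x < y

namespace FiniteStage

variable {W : Type*} [LinearOrder W] {T : Set W}

/-- Extensions freeze the relation on the old support, so types and their witnesses survive to the
limit. -/
instance : Preorder (FiniteStage T) where
  le s s' := s.support ⊆ s'.support ∧
    ∀ x ∈ s.support, ∀ y ∈ s.support, s'.rel x y ↔ s.rel x y
  le_refl s := ⟨subset_rfl, fun _ _ _ _ => Iff.rfl⟩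
  le_trans s s' s'' h h' := ⟨h.1.trans h'.1, fun x hx y hy =>
    (h'.2 x (h.1 hx) y (h.1 hy)).trans (h.2 x hx y hy)⟩

theorem exists_le_support (s : FiniteStage T) (F : Finset W) :
    ∃ s', s ≤ s' ∧ F ⊆ s'.support :=
  ⟨{ s with
      support := s.support ∪ F
      mem_of_rel := fun x y h => ⟨Finset.mem_union_left _ (s.mem_of_rel x y h).1,
        Finset.mem_union_left _ (s.mem_of_rel x y h).2⟩ },
    ⟨Finset.subset_union_left, fun _ _ _ _ => Iff.rfl⟩, Finset.subset_union_right⟩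

/-- `z` is a witness for the one-point extension given by `A`, `B`, `C`. -/
def IsWitness {W : Type*} (r : W → W → Prop) (A B C : Finset W) (z : W) : Prop :=
  (∀ a ∈ A, r a z) ∧ (∀ b ∈ B, r z b) ∧ ∀ c ∈ C, c ≠ z ∧ ¬ r c z ∧ ¬ r z c

/-- `A`, `B`, `C` describe a one-point extension of the strict order `r`. -/
def IsType {W : Type*} (r : W → W → Prop) (A B C : Finset W) : Prop :=
  (∀ a ∈ A, ∀ b ∈ B, r a b) ∧ (∀ c ∈ C, ∀ a ∈ A, c ≠ a ∧ ¬ r c a) ∧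
    ∀ c ∈ C, ∀ b ∈ B, c ≠ b ∧ ¬ r b c

/-- A fresh `z` is put just above the down-closure of `A` and below the up-closure of `B`. The
constraint asks `z` to exceed the `T`-points under it and, as `z` itself may lie in `T`, to precede
everything over it. -/
theorem exists_le_witness
    (hW : ∀ S M : Finset W, (∀ s ∈ S, s ∈ T) → M.Nonempty → (∀ s ∈ S, ∀ m ∈ M, s < m) →
      ∃ z, (∀ s ∈ S, s < z) ∧ ∀ m ∈ M, z < m)
    (s : FiniteStage T) {A B C : Finset W} (hA : A ⊆ s.support) (hB : B ⊆ s.support)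
    (hC : C ⊆ s.support) (h : IsType s.rel A B C) {w : W}
    (hw : ∀ a ∈ A, a < w ∨ a = w ∧ a ∉ T) :
    ∃ s', s ≤ s' ∧ ∃ z ∈ s'.support, z < w ∧ IsWitness s'.rel A B C z := by
  classical
  obtain ⟨hAB, hCA, hCB⟩ := h
  let low (x : W) : Prop := ∃ a ∈ A, x = a ∨ s.rel x a
  let upp (x : W) : Prop := ∃ b ∈ B, x = b ∨ s.rel b x
  have hlow : ∀ x, low x → x ∈ s.support := by
    rintro x ⟨a, ha, rfl | hx⟩
    exacts [hA ha, (s.mem_of_rel _ _ hx).1]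
  have hupp : ∀ x, upp x → x ∈ s.support := by
    rintro x ⟨b, hb, rfl | hx⟩
    exacts [hB hb, (s.mem_of_rel _ _ hx).2]
  have hlu : ∀ x y, low x → upp y → s.rel x y := by
    rintro x y ⟨a, ha, hx⟩ ⟨b, hb, hy⟩
    have hab := hAB a ha b hb
    have hxb : s.rel x b := by
      rcases hx with rfl | hx
      exacts [hab, s.trans _ _ _ hx hab]
    rcases hy with rfl | hy
    exacts [hxb, s.trans _ _ _ hxb hy]
  have hll : ∀ x y, s.rel x y → low y → low x := by
    rintro x y hxy ⟨a, ha, rfl | hy⟩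
    exacts [⟨y, ha, Or.inr hxy⟩, ⟨a, ha, Or.inr (s.trans _ _ _ hxy hy)⟩]
  have huu : ∀ x y, s.rel x y → upp x → upp y := by
    rintro x y hxy ⟨b, hb, rfl | hy⟩
    exacts [⟨x, hb, Or.inr hxy⟩, ⟨b, hb, Or.inr (s.trans _ _ _ hy hxy)⟩]
  have hloww : ∀ x, low x → x ∈ T → x < w := by
    rintro x ⟨a, ha, rfl | hx⟩ hT
    · exact (hw x ha).resolve_right fun h => h.2 hT
    · have := s.lt_of_rel _ _ hx hT
      rcases hw a ha with h | h
      exacts [this.trans h, h.1 ▸ this]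
  let S := s.support.filter fun x => low x ∧ x ∈ T
  -- The second disjunct forces freshness: an old `z` above all of `S` would belong to `M`, giving
  -- `z < z`.
  let M := insert w (s.support.filter fun x => upp x ∨ ∀ e ∈ S, e < x)
  obtain ⟨z, hSz, hzM⟩ := hW S M (fun x hx => (Finset.mem_filter.1 hx).2.2)
    (Finset.insert_nonempty _ _) (by
      intro e he m hm
      have he' := (Finset.mem_filter.1 he).2
      rcases Finset.mem_insert.1 hm with rfl | hm
      · exact hloww e he'.1 he'.2
      · rcases (Finset.mem_filter.1 hm).2 with hm | hm
        · exact s.lt_of_rel _ _ (hlu e m he'.1 hm) he'.2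
        · exact hm e he)
  have hz : z ∉ s.support := fun hz => lt_irrefl z <|
    hzM z (Finset.mem_insert_of_mem (Finset.mem_filter.2 ⟨hz, Or.inr hSz⟩))
  have hzl : ¬ low z := fun h => hz (hlow z h)
  have hzu : ¬ upp z := fun h => hz (hupp z h)
  have hzr : ∀ x, ¬ s.rel x z := fun x h => hz (s.mem_of_rel _ _ h).2
  have hzr' : ∀ x, ¬ s.rel z x := fun x h => hz (s.mem_of_rel _ _ h).1
  have hne : ∀ x ∈ s.support, x ≠ z := fun x hx h => hz (h ▸ hx)
  refine ⟨{ support := insert z s.support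
            rel := fun x y => s.rel x y ∨ (low x ∧ y = z) ∨ (x = z ∧ upp y)
            mem_of_rel := ?_
            irrefl := ?_
            trans := ?_
            lt_of_rel := ?_ }, ⟨Finset.subset_insert _ _, ?_⟩, z, Finset.mem_insert_self _ _,
            hzM w (Finset.mem_insert_self _ _), ?_, ?_, ?_⟩
  · rintro x y (h | ⟨h, rfl⟩ | ⟨rfl, h⟩)
    · exact ⟨Finset.mem_insert_of_mem (s.mem_of_rel _ _ h).1,
        Finset.mem_insert_of_mem (s.mem_of_rel _ _ h).2⟩
    · exact ⟨Finset.mem_insert_of_mem (hlow x h), Finset.mem_insert_self _ _⟩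
    · exact ⟨Finset.mem_insert_self _ _, Finset.mem_insert_of_mem (hupp y h)⟩
  · rintro x (h | ⟨h, rfl⟩ | ⟨rfl, h⟩)
    exacts [s.irrefl x h, hzl h, hzu h]
  · rintro x y u (h | ⟨h, rfl⟩ | ⟨rfl, h⟩) (h' | ⟨h', h''⟩ | ⟨h', h''⟩)
    · exact Or.inl (s.trans _ _ _ h h')
    · exact Or.inr (Or.inl ⟨hll _ _ h h', h''⟩)
    · exact absurd (h' ▸ h) (hzr x)
    · exact absurd h' (hzr' u)
    · exact absurd h' hzl
    · exact Or.inl (hlu _ _ h h'')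
    · exact Or.inr (Or.inr ⟨rfl, huu _ _ h' h⟩)
    · exact absurd (hlu _ _ h' h) (s.irrefl y)
    · exact absurd (h' ▸ h) hzu
  · rintro x y (h | ⟨h, rfl⟩ | ⟨rfl, h⟩) hT
    · exact s.lt_of_rel _ _ h hT
    · exact hSz x (Finset.mem_filter.2 ⟨hlow x h, h, hT⟩)
    · exact hzM y (Finset.mem_insert_of_mem (Finset.mem_filter.2 ⟨hupp y h, Or.inl h⟩))
  · intro x hx y hy
    simp [hne x hx, hne y hy]
  · exact fun a ha => Or.inr (Or.inl ⟨⟨a, ha, Or.inl rfl⟩, rfl⟩)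
  · exact fun b hb => Or.inr (Or.inr ⟨rfl, b, hb, Or.inl rfl⟩)
  · intro c hc
    have hcz := hne c (hC hc)
    refine ⟨hcz, ?_, ?_⟩
    · rintro (h | ⟨⟨a, ha, h⟩, -⟩ | ⟨h, -⟩)
      · exact hzr c h
      · exact h.elim (hCA c hc a ha).1 (hCA c hc a ha).2
      · exact hcz h
    · rintro (h | ⟨-, h⟩ | ⟨-, b, hb, h⟩)
      · exact hzr' c h
      · exact hcz h
      · exact h.elim (hCB c hc b hb).1 (hCB c hc b hb).2

theorem isType_congr {W : Type*} {r r' : W → W → Prop} {A B C : Finset W} {F : Finset W} (hA : A ⊆ F)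
    (hB : B ⊆ F) (hC : C ⊆ F) (h : ∀ x ∈ F, ∀ y ∈ F, r x y ↔ r' x y) (ht : IsType r A B C) :
    IsType r' A B C :=
  ⟨fun a ha b hb => (h a (hA ha) b (hB hb)).1 (ht.1 a ha b hb),
    fun c hc a ha => ⟨(ht.2.1 c hc a ha).1, fun h' => (ht.2.1 c hc a ha).2
      ((h c (hC hc) a (hA ha)).2 h')⟩,
    fun c hc b hb => ⟨(ht.2.2 c hc b hb).1, fun h' => (ht.2.2 c hc b hb).2
      ((h b (hB hb) c (hC hc)).2 h')⟩⟩

theorem isWitness_congr {W : Type*} {r r' : W → W → Prop} {A B C : Finset W} {z : W} {F : Finset W}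
    (hA : A ⊆ F) (hB : B ⊆ F) (hC : C ⊆ F) (hz : z ∈ F)
    (h : ∀ x ∈ F, ∀ y ∈ F, r x y ↔ r' x y) (ht : IsWitness r A B C z) :
    IsWitness r' A B C z :=
  ⟨fun a ha => (h a (hA ha) z hz).1 (ht.1 a ha),
    fun b hb => (h z hz b (hB hb)).1 (ht.2.1 b hb),
    fun c hc => ⟨(ht.2.2 c hc).1, fun h' => (ht.2.2 c hc).2.1 ((h c (hC hc) z hz).2 h'),
      fun h' => (ht.2.2 c hc).2.2 ((h z hz c (hC hc)).2 h')⟩⟩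

theorem exists_generic [Countable W]
    (hW : ∀ S M : Finset W, (∀ s ∈ S, s ∈ T) → M.Nonempty → (∀ s ∈ S, ∀ m ∈ M, s < m) →
      ∃ z, (∀ s ∈ S, s < z) ∧ ∀ m ∈ M, z < m) :
    ∃ r : W → W → Prop, (∀ x, ¬ r x x) ∧ (∀ x y z, r x y → r y z → r x z) ∧
      (∀ x y, r x y → x ∈ T → x < y) ∧
      ∀ A B C : Finset W, IsType r A B C → ∀ w, (∀ a ∈ A, a < w ∨ a = w ∧ a ∉ T) →
        ∃ z < w, IsWitness r A B C z := by
  classical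
  have := Encodable.ofCountable W
  let meet (i : Finset W × Finset W × Finset W × W) : Order.Cofinal (FiniteStage T) :=
    { carrier := {s | (i.1 ⊆ s.support ∧ i.2.1 ⊆ s.support ∧ i.2.2.1 ⊆ s.support) ∧
        (IsType s.rel i.1 i.2.1 i.2.2.1 → (∀ a ∈ i.1, a < i.2.2.2 ∨ a = i.2.2.2 ∧ a ∉ T) →
          ∃ z ∈ s.support, z < i.2.2.2 ∧ IsWitness s.rel i.1 i.2.1 i.2.2.1 z)}
      isCofinal := fun s => by
        obtain ⟨A, B, C, w⟩ := i
        obtain ⟨s₁, hs₁, hF⟩ := s.exists_le_support (A ∪ B ∪ C)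
        have hA : A ⊆ s₁.support := fun x hx => hF (by simp [hx])
        have hB : B ⊆ s₁.support := fun x hx => hF (by simp [hx])
        have hC : C ⊆ s₁.support := fun x hx => hF (by simp [hx])
        by_cases h : IsType s₁.rel A B C ∧ ∀ a ∈ A, a < w ∨ a = w ∧ a ∉ T
        · obtain ⟨s₂, hs₂, hz⟩ := exists_le_witness hW s₁ hA hB hC h.1 h.2
          exact ⟨s₂, ⟨⟨hA.trans hs₂.1, hB.trans hs₂.1, hC.trans hs₂.1⟩, fun _ _ => hz⟩,
            hs₁.trans hs₂⟩
        -- The demand is void here and stays so, since `A`, `B`, `C` are already in the support.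
        · exact ⟨s₁, ⟨⟨hA, hB, hC⟩, fun h₁ h₂ => absurd ⟨h₁, h₂⟩ h⟩, hs₁⟩ }
  let s₀ : FiniteStage T :=
    { support := ∅
      rel := fun _ _ => False
      mem_of_rel := fun _ _ => False.elim
      irrefl := fun _ => id
      trans := fun _ _ _ => False.elim
      lt_of_rel := fun _ _ => False.elim }
  let I := Order.idealOfCofinals s₀ meet
  have hrel : ∀ s ∈ I, ∀ x ∈ s.support, ∀ y ∈ s.support,
      s.rel x y ↔ ∃ s ∈ I, s.rel x y := by
    refine fun s hs x hx y hy => ⟨fun h => ⟨s, hs, h⟩, ?_⟩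
    rintro ⟨s', hs', h⟩
    obtain ⟨u, -, hu, hu'⟩ := I.directed s hs s' hs'
    have hm := s'.mem_of_rel _ _ h
    exact (hu.2 x hx y hy).1 ((hu'.2 x hm.1 y hm.2).2 h)
  refine ⟨fun x y => ∃ s ∈ I, s.rel x y, ?_, ?_, ?_, ?_⟩
  · rintro x ⟨s, -, h⟩
    exact s.irrefl x h
  · rintro x y z ⟨s, hs, h⟩ ⟨s', hs', h'⟩
    obtain ⟨u, huI, hu, hu'⟩ := I.directed s hs s' hs'
    have hm := s.mem_of_rel _ _ h
    have hm' := s'.mem_of_rel _ _ h'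
    exact ⟨u, huI, u.trans _ _ _ ((hu.2 x hm.1 y hm.2).2 h) ((hu'.2 y hm'.1 z hm'.2).2 h')⟩
  · rintro x y ⟨s, -, h⟩
    exact s.lt_of_rel x y h
  · intro A B C ht w hw
    obtain ⟨s, ⟨⟨hA, hB, hC⟩, h⟩, hs⟩ :=
      Order.cofinal_meets_idealOfCofinals s₀ meet (A, B, C, w)
    obtain ⟨z, hz, hzw, hwit⟩ := h
      (isType_congr hA hB hC (fun x hx y hy => (hrel s hs x hx y hy).symm) ht) hw
    exact ⟨z, hzw, isWitness_congr hA hB hC hz (hrel s hs) hwit⟩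

end FiniteStage

/-! ### Countable label sets and the labelling -/

/-- A countable set `W` of labels in a linear order `L` with bottom `o`: it consists of all the
points with an immediate predecessor and of the points of a set `T` of two-sided limits, and
accumulates from the right at each point without an immediate successor. -/
structure IsLabelSet {L : Type*} [LinearOrder L] (o : L) (W T : Set L) : Prop where
  bot_le : ∀ x, o ≤ x
  bot_not_covBy : ∀ y, ¬ o ⋖ y
  countable : W.Countable
  subset : T ⊆ W
  bot_lt : ∀ w ∈ W, o < w
  not_covBy_left : ∀ t ∈ T, ∀ y, ¬ y ⋖ t
  not_covBy_right : ∀ t ∈ T, ∀ y, ¬ t ⋖ y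
  exists_gt : ∀ t ∈ T, ∃ y, t < y
  mem_of_covBy : ∀ x y, y ⋖ x → x ∈ W
  exists_covBy : ∀ w ∈ W, w ∉ T → ∃ y, y ⋖ w
  exists_between : ∀ a x, a < x → (∀ y, ¬ a ⋖ y) → ∃ w ∈ W, a < w ∧ w < x

/-- Each jump contains a rational, and different jumps are disjoint. -/
theorem IsRealEmbeddable.countable_covBy {L : Type*} [LinearOrder L] (h : IsRealEmbeddable L) :
    {x : L | ∃ y, y ⋖ x}.Countable := by
  obtain ⟨e⟩ := h
  have hq : ∀ x : L, (∃ y, y ⋖ x) → ∃ q : ℚ, (q : ℝ) < e x ∧ ∀ z < x, e z < q := by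
    rintro x ⟨y, hy⟩
    obtain ⟨q, hq, hq'⟩ := exists_rat_btwn (e.lt_iff_lt.2 hy.lt)
    exact ⟨q, hq', fun z hz => (e.le_iff_le.2 (hy.le_of_lt hz)).trans_lt hq⟩
  choose! q hq hq' using hq
  refine Set.MapsTo.countable_of_injOn (f := q) (t := Set.univ) (fun _ _ => Set.mem_univ _) ?_
    Set.countable_univ
  intro x hx y hy hxy
  by_contra hne
  rcases lt_or_gt_of_ne hne with h | h
  · have := hq' y hy x h
    rw [← hxy] at this
    exact (this.trans (hq x hx)).false
  · have := hq' x hx y h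
    rw [hxy] at this
    exact (this.trans (hq y hy)).false

theorem IsRealEmbeddable.exists_countable_meets_Ioo {L : Type*} [LinearOrder L]
    (h : IsRealEmbeddable L) :
    ∃ S : Set L, S.Countable ∧ ∀ a m c : L, a < m → m < c → ∃ s ∈ S, a < s ∧ s < c := by
  obtain ⟨e⟩ := h
  have hs : ∀ p : ℚ × ℚ, ∃ S : Set L, S.Countable ∧ ∀ m : L, (p.1 : ℝ) < e m → e m < p.2 →
      ∃ s ∈ S, (p.1 : ℝ) < e s ∧ e s < p.2 := by
    intro p
    by_cases hp : ∃ m : L, (p.1 : ℝ) < e m ∧ e m < p.2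
    · obtain ⟨m, hm⟩ := hp
      exact ⟨{m}, Set.countable_singleton m, fun _ _ _ => ⟨m, rfl, hm⟩⟩
    · exact ⟨∅, Set.countable_empty, fun m h₁ h₂ => absurd ⟨m, h₁, h₂⟩ hp⟩
  choose S hS hS' using hs
  refine ⟨⋃ p, S p, Set.countable_iUnion hS, fun a m c ham hmc => ?_⟩
  obtain ⟨p, hp, hp'⟩ := exists_rat_btwn (e.lt_iff_lt.2 ham)
  obtain ⟨q, hq, hq'⟩ := exists_rat_btwn (e.lt_iff_lt.2 hmc)
  obtain ⟨s, hs, hs₁, hs₂⟩ := hS' (p, q) m hp' hq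
  exact ⟨s, Set.mem_iUnion.2 ⟨_, hs⟩, e.lt_iff_lt.1 (hp.trans hs₁), e.lt_iff_lt.1 (hs₂.trans hq')⟩

theorem IsRealEmbeddable.exists_isLabelSet {L : Type*} [LinearOrder L]
    (h : IsRealEmbeddable L) {o : L} (ho : IsBot o)
    (ho' : ∀ x, o < x → ∃ y, o < y ∧ y < x) : ∃ W T : Set L, IsLabelSet o W T := by
  obtain ⟨S, hS, hS'⟩ := h.exists_countable_meets_Ioo
  let T : Set L := {x | x ∈ S ∧ (∀ y, ¬ y ⋖ x) ∧ (∀ y, ¬ x ⋖ y) ∧ o < x ∧ ∃ y, x < y}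
  refine ⟨{x | ∃ y, y ⋖ x} ∪ T, T, ?_⟩
  have hbetween : ∀ {a x : L}, a < x → ¬ a ⋖ x → ∃ m, a < m ∧ m < x :=
    fun {a x} hax h => (not_covBy_iff hax).1 h
  refine
    { bot_le := ho
      bot_not_covBy := fun y hy => ?_
      countable := h.countable_covBy.union (hS.mono fun _ hx => hx.1)
      subset := Set.subset_union_right
      bot_lt := ?_
      not_covBy_left := fun t ht => ht.2.1
      not_covBy_right := fun t ht => ht.2.2.1
      exists_gt := fun t ht => ht.2.2.2.2
      mem_of_covBy := fun x y hy => Or.inl ⟨y, hy⟩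
      exists_covBy := fun w hw hwT => hw.resolve_right hwT
      exists_between := fun a x hax ha => ?_ }
  · obtain ⟨z, hz, hz'⟩ := ho' y hy.lt
    exact hy.2 hz hz'
  · rintro w (⟨y, hy⟩ | hw)
    exacts [(ho y).trans_lt hy.lt, hw.2.2.2.1]
  · by_cases hj : ∃ w, (∃ y, y ⋖ w) ∧ a < w ∧ w < x
    · obtain ⟨w, hw, haw, hwx⟩ := hj
      exact ⟨w, Or.inl hw, haw, hwx⟩
    -- The interval contains no upper end of a jump. The spare point `x'` keeps a successor of `s`
    -- inside the interval, so `s` is a two-sided limit.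
    · obtain ⟨x', hax', hx'⟩ := hbetween hax (ha x)
      obtain ⟨m, ham, hm⟩ := hbetween hax' (ha x')
      obtain ⟨s, hs, has, hsx⟩ := hS' a m x' ham hm
      refine ⟨s, Or.inr ⟨hs, fun y hy => hj ⟨s, ⟨y, hy⟩, has, hsx.trans hx'⟩, fun y hy => ?_,
        (ho a).trans_lt has, x', hsx⟩, has, hsx.trans hx'⟩
      exact hj ⟨y, ⟨s, hy⟩, has.trans hy.lt, (hy.ge_of_gt hsx).trans_lt hx'⟩

namespace IsLabelSet

variable {L : Type*} [LinearOrder L] {o : L} {W T : Set L}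

/-- Needed because `x` itself may not be a label. The maximum of `A` serves unless it lies in `T`;
then it has no immediate successor and a label fits above it. -/
theorem exists_label_le (h : IsLabelSet o W T) {x : L} (hx : o < x) (A : Finset L)
    (hA : ∀ a ∈ A, a ∈ W) (hAx : ∀ a ∈ A, a < x ∨ a = x ∧ a ∉ T) :
    ∃ w ∈ W, w ≤ x ∧ ∀ a ∈ A, a < w ∨ a = w ∧ a ∉ T := by
  rcases A.eq_empty_or_nonempty with rfl | hne
  · obtain ⟨w, hw, -, hwx⟩ := h.exists_between o x hx h.bot_not_covBy
    exact ⟨w, hw, hwx.le, by simp⟩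
  have hm := A.max'_mem hne
  by_cases hT : A.max' hne ∈ T
  · obtain ⟨w, hw, hmw, hwx⟩ := h.exists_between _ x
      ((hAx _ hm).resolve_right fun h' => h'.2 hT) (h.not_covBy_right _ hT)
    exact ⟨w, hw, hwx.le, fun a ha => Or.inl ((A.le_max' a ha).trans_lt hmw)⟩
  · refine ⟨A.max' hne, hA _ hm, (hAx _ hm).elim le_of_lt fun h' => h'.1.le, fun a ha => ?_⟩
    rcases (A.le_max' a ha).lt_or_eq with h' | h'
    exacts [Or.inl h', Or.inr ⟨h', h' ▸ hT⟩]

theorem exists_between_finsets (h : IsLabelSet o W T) (S M : Finset W) (hS : ∀ s ∈ S, (s : L) ∈ T)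
    (hM : M.Nonempty) (hSM : ∀ s ∈ S, ∀ m ∈ M, s < m) :
    ∃ z : W, (∀ s ∈ S, s < z) ∧ ∀ m ∈ M, z < m := by
  have hm := M.min'_mem hM
  obtain ⟨a, hac, ha, haS⟩ : ∃ a : L, (∀ y, ¬ a ⋖ y) ∧ a < M.min' hM ∧ ∀ s ∈ S, (s : L) ≤ a := by
    rcases S.eq_empty_or_nonempty with rfl | hne
    · exact ⟨o, h.bot_not_covBy, h.bot_lt _ (M.min' hM).2, by simp⟩
    · exact ⟨S.max' hne, h.not_covBy_right _ (hS _ (S.max'_mem hne)),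
        hSM _ (S.max'_mem hne) _ hm, fun s hs => S.le_max' s hs⟩
  obtain ⟨w, hw, haw, hwm⟩ := h.exists_between _ _ ha hac
  exact ⟨⟨w, hw⟩, fun s hs => (haS s hs).trans_lt haw, fun m hm' =>
    lt_of_lt_of_le (b := M.min' hM) hwm (M.min'_le m hm')⟩

/-- The random poset admits a bijective labelling by `W` which is strictly monotone at the points
labelled by `T` and generic subject to this constraint. -/
theorem exists_labelling (h : IsLabelSet o W T) {i : L} (hi : IsTop i) (hoi : o < i)
    {D : Type*} [PartialOrder D] (hD : IsRandomPoset D) :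
    ∃ t : D → L, Function.Injective t ∧ Set.range t = W ∧
      (∀ d e, d < e → t d ∈ T → t d < t e) ∧
      ∀ A B C : Finset D, (∀ a ∈ A, ∀ b ∈ B, a < b) → (∀ c ∈ C, ∀ a ∈ A, ¬ c ≤ a) →
        (∀ c ∈ C, ∀ b ∈ B, ¬ b ≤ c) → ∀ w ∈ W, (∀ a ∈ A, t a < w ∨ t a = w ∧ t a ∉ T) →
        ∃ z, t z < w ∧ (∀ a ∈ A, a < z) ∧ (∀ b ∈ B, z < b) ∧ ∀ c ∈ C, ¬ c ≤ z ∧ ¬ z ≤ c := by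
  classical
  have := h.countable.to_subtype
  have := hD.countable
  obtain ⟨r, hirr, htr, hrT, hgen⟩ := FiniteStage.exists_generic (W := W)
    (T := Subtype.val ⁻¹' T) h.exists_between_finsets
  let inst : PartialOrder W :=
    { le := fun x y => x = y ∨ r x y
      lt := r
      le_refl := fun x => Or.inl rfl
      le_trans := by
        rintro x y z (rfl | hxy) (rfl | hyz)
        exacts [Or.inl rfl, Or.inr hyz, Or.inr hxy, Or.inr (htr _ _ _ hxy hyz)]
      le_antisymm := by
        rintro x y (rfl | hxy) (h' | hyx)
        exacts [rfl, rfl, h'.symm, absurd (htr _ _ _ hxy hyx) (hirr x)]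
      lt_iff_le_not_ge := fun x y => by
        refine ⟨fun hxy => ⟨Or.inr hxy, ?_⟩, fun ⟨h₁, h₂⟩ => ?_⟩
        · rintro (rfl | hyx)
          exacts [hirr _ hxy, hirr _ (htr _ _ _ hxy hyx)]
        · exact h₁.resolve_left fun h' => h₂ (Or.inl h'.symm) }
  have hext : @HasExtensionProperty W inst := by
    intro A B C hAB hCA hCB
    -- The top is an admissible bound for any finite set, since points of `T` have something above
    -- them.
    obtain ⟨w, hw, -, hAw⟩ := h.exists_label_le hoi (A.image Subtype.val)
      (Finset.forall_mem_image.2 fun a _ => a.2)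
      (by
        simp only [Finset.forall_mem_image]
        intro a _
        rcases (hi a).lt_or_eq with h' | h'
        · exact Or.inl h'
        · refine Or.inr ⟨h', fun hT => ?_⟩
          obtain ⟨y, hy⟩ := h.exists_gt _ hT
          exact (h' ▸ hy).not_ge (hi y))
    simp only [Finset.forall_mem_image] at hAw
    obtain ⟨z, -, hA, hB, hC⟩ := hgen A B C
      ⟨hAB, fun c hc a ha => not_or.1 (hCA c hc a ha),
        fun c hc b hb => ⟨fun h' => (hCB c hc b hb) (Or.inl h'.symm),
          fun h' => hCB c hc b hb (Or.inr h')⟩⟩ ⟨w, hw⟩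
      (fun a ha => (hAw ha).imp id fun h' => ⟨Subtype.ext h'.1, h'.2⟩)
    exact ⟨z, hA, hB, fun c hc => ⟨not_or.2 ⟨(hC c hc).1, (hC c hc).2.1⟩,
      not_or.2 ⟨(hC c hc).1.symm, (hC c hc).2.2⟩⟩⟩
  obtain ⟨φ, hlt, hle⟩ : ∃ φ : D ≃ W, (∀ d e, d < e ↔ r (φ d) (φ e)) ∧
      ∀ d e, d ≤ e ↔ φ d = φ e ∨ r (φ d) (φ e) := by
    have e : Nonempty (@OrderIso D W _ inst.toLE) :=
      @HasExtensionProperty.nonempty_orderIso D W _ inst _ _ hD.hasExtensionProperty hext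
    obtain ⟨ψ⟩ := e
    exact ⟨ψ.toEquiv, fun d e => (@OrderIso.lt_iff_lt D W _ inst.toPreorder ψ d e).symm,
      fun d e => (@OrderIso.le_iff_le D W _ inst.toLE ψ d e).symm⟩
  refine ⟨fun d => φ d, Subtype.val_injective.comp φ.injective, ?_, ?_, ?_⟩
  · ext w
    exact ⟨by rintro ⟨d, rfl⟩; exact (φ d).2, fun hw => ⟨φ.symm ⟨w, hw⟩, by simp⟩⟩
  · exact fun d e hde hT => hrT _ _ ((hlt d e).1 hde) hT
  · intro A B C hAB hCA hCB w hw hAw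
    obtain ⟨z, hzw, hA, hB, hC⟩ := hgen (A.image φ) (B.image φ) (C.image φ)
      (by
        simp only [FiniteStage.IsType, Finset.forall_mem_image, ← hlt, ← not_or]
        refine ⟨fun a ha b hb => hAB a ha b hb, fun c hc a ha => ?_, fun c hc b hb => ?_⟩
        · rw [hlt, ← hle]
          exact hCA c hc a ha
        · rw [hlt, eq_comm, ← hle]
          exact hCB c hc b hb) ⟨w, hw⟩
      (by
        simp only [Finset.forall_mem_image]
        exact fun a ha => (hAw a ha).imp id fun h' => ⟨Subtype.ext h'.1, h'.2⟩)
    obtain ⟨z, rfl⟩ := φ.surjective z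
    simp only [Finset.forall_mem_image, ← hlt] at hA hB hC
    refine ⟨z, hzw, fun a ha => hA ha, fun b hb => hB hb, fun c hc => ⟨?_, ?_⟩⟩
    · rw [hle, ← hlt]
      exact not_or.2 ⟨(hC hc).1, (hC hc).2.1⟩
    · rw [hle, ← hlt]
      exact not_or.2 ⟨(hC hc).1.symm, (hC hc).2.2⟩

end IsLabelSet

/-! ### Sections and maximality of the chain -/

theorem IsCompleteLinearOrder.exists_isLUB {L : Type*} [LinearOrder L]
    (h : IsCompleteLinearOrder L) (S : Set L) : ∃ x, IsLUB S x := by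
  obtain ⟨o, ho⟩ := h.exists_bot
  obtain ⟨i, hi⟩ := h.exists_top
  by_cases hoS : o ∈ upperBounds S
  · exact ⟨o, hoS, fun y _ => ho y⟩
  rcases h.no_gaps (upperBounds S)ᶜ (upperBounds S) ⟨o, hoS⟩ ⟨i, fun y _ => hi y⟩
    (Set.compl_union_self _) (fun a ha b hb => lt_of_not_ge fun hba =>
      ha fun s hs => (hb hs).trans hba) with ⟨m, hm, hm'⟩ | hm
  -- If the non-upper bounds have a maximum `m`, any element of `S` above `m` is an upper bound,
  -- hence the supremum.
  · obtain ⟨s, hs, hms⟩ : ∃ s ∈ S, m < s := by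
      simpa [upperBounds] using hm
    have hsu : s ∈ upperBounds S := by
      by_contra hsu
      exact (hm' hsu).not_gt hms
    exact ⟨s, hsu, fun y hy => hy hs⟩
  · exact hm

theorem HasExtensionProperty.exists_gt {P : Type*} [PartialOrder P]
    (h : HasExtensionProperty P) (x : P) : ∃ y, x < y := by
  obtain ⟨z, hz, -⟩ := h {x} ∅ ∅ (by simp) (by simp) (by simp)
  exact ⟨z, hz x (Finset.mem_singleton_self x)⟩

/-- The elements whose label is at most `x`, without the one labelled `x` if `x ∈ T`. -/
def labelSection {D L : Type*} [LT L] (t : D → L) (T : Set L) (x : L) : Set D :=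
  {d | t d < x ∨ t d = x ∧ t d ∉ T}

/-- Genericity applied with a label `w ≤ x` puts the witness inside the section. -/
theorem IsLabelSet.labelSection_mem_copies {L : Type*} [LinearOrder L] {o : L} {W T : Set L}
    (h : IsLabelSet o W T) {D : Type*} [PartialOrder D] (hD : IsRandomPoset D) {t : D → L}
    (ht : ∀ d, t d ∈ W)
    (hgen : ∀ A B C : Finset D, (∀ a ∈ A, ∀ b ∈ B, a < b) → (∀ c ∈ C, ∀ a ∈ A, ¬ c ≤ a) →
        (∀ c ∈ C, ∀ b ∈ B, ¬ b ≤ c) → ∀ w ∈ W, (∀ a ∈ A, t a < w ∨ t a = w ∧ t a ∉ T) →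
        ∃ z, t z < w ∧ (∀ a ∈ A, a < z) ∧ (∀ b ∈ B, z < b) ∧ ∀ c ∈ C, ¬ c ≤ z ∧ ¬ z ≤ c)
    {x : L} (hx : o < x) : labelSection t T x ∈ copies D := by
  classical
  have := hD.countable
  refine HasExtensionProperty.nonempty_orderIso (fun A B C hAB hCA hCB => ?_)
    hD.hasExtensionProperty
  obtain ⟨w, hw, hwx, hAw⟩ := h.exists_label_le hx (A.image fun a : labelSection t T x => t a)
    (Finset.forall_mem_image.2 fun a _ => ht a) (Finset.forall_mem_image.2 fun a _ => a.2)
  simp only [Finset.forall_mem_image] at hAw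
  obtain ⟨z, hzw, hA, hB, hC⟩ := hgen (A.image Subtype.val) (B.image Subtype.val)
    (C.image Subtype.val)
    (by simp only [Finset.forall_mem_image]; exact fun a ha b hb => hAB a ha b hb)
    (by simp only [Finset.forall_mem_image]; exact fun c hc a ha => hCA c hc a ha)
    (by simp only [Finset.forall_mem_image]; exact fun c hc b hb => hCB c hc b hb) w hw
    (by simp only [Finset.forall_mem_image]; exact fun a ha => hAw ha)
  simp only [Finset.forall_mem_image] at hA hB hC
  exact ⟨⟨z, Or.inl (hzw.trans_le hwx)⟩, fun a ha => hA ha, fun b hb => hB hb, fun c hc => hC hc⟩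

theorem not_mem_copies_of_isMaximal {D : Type*} [PartialOrder D] (hD : IsRandomPoset D)
    {C : Set D} {d : D} (hd : d ∈ C) (hmax : ∀ e ∈ C, ¬ d < e) : C ∉ copies D := by
  rintro ⟨φ⟩
  obtain ⟨y, hy⟩ := hD.hasExtensionProperty.exists_gt (φ ⟨d, hd⟩)
  obtain ⟨e, rfl⟩ := φ.surjective y
  exact hmax e e.2 (φ.lt_iff_lt.1 hy)

theorem IsLabelSet.labelSection_strictMono {L : Type*} [LinearOrder L] {o : L} {W T : Set L}
    (h : IsLabelSet o W T) {D : Type*} {t : D → L} (ht : Set.range t = W) {x y : L} (hxy : x < y) :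
    labelSection t T x ⊂ labelSection t T y := by
  refine (Set.ssubset_iff_of_subset ?_).2 ?_
  · rintro d (hd | ⟨hd, -⟩)
    exacts [Or.inl (hd.trans hxy), Or.inl (hd.trans_lt hxy)]
  · obtain ⟨w, hw, hxw, hwy⟩ : ∃ w ∈ W, x < w ∧ (w < y ∨ w = y ∧ w ∉ T) := by
      by_cases hx : ∃ y, x ⋖ y
      · obtain ⟨z, hz⟩ := hx
        exact ⟨z, h.mem_of_covBy z x hz, hz.lt, (hz.ge_of_gt hxy).lt_or_eq.imp id fun h' =>
          ⟨h', fun hT => h.not_covBy_left z hT x hz⟩⟩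
      · obtain ⟨w, hw, hxw, hwy⟩ := h.exists_between x y hxy (not_exists.1 hx)
        exact ⟨w, hw, hxw, Or.inl hwy⟩
    rw [← ht] at hw
    obtain ⟨d, rfl⟩ := hw
    exact ⟨d, hwy, not_or.2 ⟨hxw.not_gt, fun h' => hxw.ne' h'.1⟩⟩

/-- A set comparable to all the sections is a section, or a section together with one further
point, whose label is in `T`. -/
theorem IsLabelSet.eq_labelSection_or {L : Type*} [LinearOrder L] {o : L} {W T : Set L}
    (h : IsLabelSet o W T) (hL : IsCompleteLinearOrder L) {D : Type*} {t : D → L}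
    (ht : Set.range t = W) (hinj : Function.Injective t) {C : Set D}
    (hC : ∀ x, C ⊆ labelSection t T x ∨ labelSection t T x ⊆ C) :
    ∃ x, C = labelSection t T x ∨ ∃ d ∈ C, t d = x ∧ x ∈ T ∧ ∀ e ∈ C, t e ≤ x := by
  have htW : ∀ d, t d ∈ W := fun d => ht ▸ Set.mem_range_self d
  -- The candidate is the supremum of the indices whose sections lie in `C`.
  obtain ⟨x, hx⟩ := hL.exists_isLUB {y | labelSection t T y ⊆ C}
  have hgt : ∀ y, x < y → C ⊆ labelSection t T y := fun y hy =>
    (hC y).resolve_right fun h' => (hx.1 h').not_gt hy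
  have hmono : Monotone (labelSection t T) :=
    StrictMono.monotone fun _ _ => h.labelSection_strictMono ht
  have hlt : ∀ y, y < x → labelSection t T y ⊆ C := fun y hy => by
    obtain ⟨z, hz, hyz⟩ := (lt_isLUB_iff hx).1 hy
    exact (hmono hyz.le).trans hz
  have hxC : labelSection t T x ⊆ C := by
    by_cases hcov : ∃ y, y ⋖ x
    · obtain ⟨y, hy⟩ := hcov
      obtain ⟨z, hz, hyz⟩ := (lt_isLUB_iff hx).1 hy.lt
      exact (hmono (hy.ge_of_gt hyz)).trans hz
    · have hlt' : ∀ d, t d < x → d ∈ C := fun d hd => by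
        obtain ⟨z, hdz, hzx⟩ := (not_covBy_iff hd).1 (not_exists.1 hcov _)
        exact hlt z hzx (Or.inl hdz)
      rintro d (hd | ⟨hd, hT⟩)
      · exact hlt' d hd
      · obtain ⟨y, hy⟩ := h.exists_covBy _ (htW d) hT
        exact absurd ⟨y, hd ▸ hy⟩ hcov
  refine ⟨x, ?_⟩
  by_cases hcov : ∃ y, x ⋖ y
  · obtain ⟨y, hy⟩ := hcov
    refine Or.inl (Set.Subset.antisymm (fun d hd => ?_) hxC)
    -- Across a jump the section gains only the point labelled `y`. If `C` contained it, the section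
    -- at `y` would lie in `C`, against the choice of `x`.
    have hy' : ∀ e, e ∈ labelSection t T y → e ∈ labelSection t T x ∨ t e = y := by
      rintro e (he | he)
      · rcases (hy.le_of_lt he).lt_or_eq with he | he
        · exact Or.inl (Or.inl he)
        · exact Or.inl (Or.inr ⟨he, fun hT => h.not_covBy_right _ hT y (he ▸ hy)⟩)
      · exact Or.inr he.1
    refine (hy' d (hgt y hy.lt hd)).resolve_right fun hdy => ?_
    refine (hx.1 (show labelSection t T y ⊆ C from fun e he => ?_)).not_gt hy.lt
    rcases hy' e he with he | he
    · exact hxC he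
    · exact hinj (he.trans hdy.symm) ▸ hd
  · have hle : ∀ e ∈ C, t e ≤ x := fun e he => by
      by_contra hlt
      obtain ⟨z, hxz, hz⟩ := (not_covBy_iff (not_le.1 hlt)).1 (not_exists.1 hcov _)
      rcases hgt z hxz he with h' | h'
      exacts [h'.not_gt hz, hz.ne h'.1.symm]
    by_cases hd : ∃ d ∈ C, t d = x ∧ x ∈ T
    · obtain ⟨d, hd, hdx, hT⟩ := hd
      exact Or.inr ⟨d, hd, hdx, hT, hle⟩
    · refine Or.inl (Set.Subset.antisymm (fun e he => ?_) hxC)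
      rcases (hle e he).lt_or_eq with h' | h'
      exacts [Or.inl h', Or.inr ⟨h', fun hT => hd ⟨e, he, h', h' ▸ hT⟩⟩]

theorem theorem4 {D : Type*} [PartialOrder D] (hD : IsRandomPoset D)
    {L : Type*} [LinearOrder L] (hLℝ : IsRealEmbeddable L) (hLc : IsCompleteLinearOrder L)
    (hL0 : HasNonisolatedBot L) :
    ∃ 𝓛 : Set {A : Set D // A ∈ copies D ∪ {∅}},
      IsMaxChain (fun A B : {A : Set D // A ∈ copies D ∪ {∅}} => A.1 ⊆ B.1) 𝓛 ∧
        Nonempty (L ≃o 𝓛) := by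
  obtain ⟨o, ho, ⟨x₀, hx₀⟩, ho'⟩ := hL0
  obtain ⟨i, hi⟩ := hLc.exists_top
  obtain ⟨W, T, h⟩ := hLℝ.exists_isLabelSet ho ho'
  obtain ⟨t, hinj, ht, hmono, hgen⟩ := h.exists_labelling hi (hx₀.trans_le (hi x₀)) hD
  have htW : ∀ d, t d ∈ W := fun d => ht ▸ Set.mem_range_self d
  have hmem : ∀ x, labelSection t T x ∈ copies D ∪ {∅} := fun x => by
    rcases (ho x).eq_or_lt with rfl | hx
    · refine Or.inr (Set.eq_empty_of_forall_notMem ?_)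
      rintro d (hd | hd)
      exacts [(h.bot_lt _ (htW d)).not_gt hd, (h.bot_lt _ (htW d)).ne' hd.1]
    · exact Or.inl (h.labelSection_mem_copies hD htW hgen hx)
  let f : L → {A : Set D // A ∈ copies D ∪ {∅}} := fun x => ⟨labelSection t T x, hmem x⟩
  have hf : StrictMono f := fun x y hxy => h.labelSection_strictMono ht hxy
  refine ⟨Set.range f, ⟨?_, fun c hc hfc => hfc.antisymm fun C hCc => ?_⟩,
    ⟨hf.orderIso f⟩⟩
  · rintro _ ⟨x, rfl⟩ _ ⟨y, rfl⟩ -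
    exact (le_total x y).imp (fun h' => hf.monotone h') fun h' => hf.monotone h'
  · have hcomp : ∀ x, C.1 ⊆ labelSection t T x ∨ labelSection t T x ⊆ C.1 := fun x => by
      rcases eq_or_ne C (f x) with rfl | hne
      · exact Or.inl subset_rfl
      · exact hc hCc (hfc ⟨x, rfl⟩) hne
    obtain ⟨x, hx | ⟨d, hd, rfl, hT, hmax⟩⟩ := h.eq_labelSection_or hLc ht hinj hcomp
    · exact ⟨x, Subtype.ext hx.symm⟩
    · rcases C.2 with hC | hC
      -- The extra point, labelled in `T`, is maximal in `C`: anything above it has a larger label.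
      · exact absurd hC (not_mem_copies_of_isMaximal hD hd fun e he hde =>
          (hmono d e hde hT).not_ge (hmax e he))
      · exact absurd hd (by rw [Set.mem_singleton_iff.1 hC]; exact Set.notMem_empty d)
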